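/- Theorem 1 (Asymptotic normality of the WiTS test). Let $P,Q$ be probability measures on a measurable space $\mathcal X$ (e.g. $\mathcal X\subseteq\mathbb R^d$), and let $h:\mathcal X\to\mathbb R$ be a fixed measurable function (the witness function) such that $\sigma_P^2:=\mathrm{Var}_{X\sim P}[h(X)]$ and $\sigma_Q^2:=\mathrm{Var}_{Y\sim Q}[h(Y)]$ satisfy $0<\sigma_P^2<\infty$ and $0<\sigma_Q^2<\infty$. Put $\bar h_P:=\mathbb E_{X\sim P}[h(X)]$ and $\bar h_Q:=\mathbb E_{Y\sim Q}[h(Y)]$. Let the sample sizes $(n,m)=(n_k,m_k)$ run through a sequence with $n_k+m_k\to\infty$ and $\frac{n_k}{n_k+m_k}\to c\in(0,1)$ as $k\to\infty$. For each $k$ let $X_1,\dots,X_n$ be i.i.d. with law $P$ and $Y_1,\dots,Y_m$ i.i.d. with law $Q$, the two samples being independent of each other (the samples for different $k$ may live on different probability spaces). Let $\hat h_P^n:=\frac1n\sum_{i=1}^n h(X_i)$ and $\hat h_Q^m:=\frac1m\sum_{j=1}^m h(Y_j)$, let $\hat\sigma_P^2,\hat\sigma_Q^2$ be the sample variances of $(h(X_i))_{i\le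 n}$ and $(h(Y_j))_{j\le m}$, either both normalized by the sample size ($\frac1n$, $\frac1m$) or both by the sample size minus one ($\frac1{n-1}$, $\frac1{m-1}$), and for $w\in(0,1)$ let $\hat\sigma_w(h):=\left(\frac{\hat\sigma_P^2}{w}+\frac{\hat\sigma_Q^2}{1-w}\right)^{1/2}$. Then, both for the constant weight $w=c$ and for the weight $w=\frac{n}{n+m}$, $$\frac{\sqrt{n+m}}{\hat\sigma_w(h)}\left[\left(\hat h_P^n-\bar h_P\right)-\left(\hat h_Q^m-\bar h_Q\right)\right]\xrightarrow{\ d\ }\mathcal N(0,1)\qquad(k\to\infty),$$ where the statistic may be given any fixed real value on the event where it is undefined, an event whose probability tends to $0$. -/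

import Mathlib

open MeasureTheory ProbabilityTheory Filter Topology

namespace WiTS

noncomputable section

/-- The empirical mean `(1/n) ∑ i, z i`. -/
def sampleMean {n : ℕ} (z : Fin n → ℝ) : ℝ :=
  (∑ i, z i) / (n : ℝ)

/-- The sample variance `1/(n - d) * ∑ i, (z i - mean)^2`: `d = 0` is the plug-in (biased) version,
`d = 1` is the unbiased version. -/
def sampleVariance (d : ℕ) {n : ℕ} (z : Fin n → ℝ) : ℝ :=
  (∑ i, (z i - sampleMean z) ^ 2) / ((n : ℝ) - (d : ℝ))

/-- The pooled sample standard deviation with weight `c`. -/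
def pooledSampleStd (d : ℕ) (c : ℝ) {n m : ℕ} (x : Fin n → ℝ) (y : Fin m → ℝ) : ℝ :=
  Real.sqrt (sampleVariance d x / c + sampleVariance d y / (1 - c))

/-- The difference of the empirical means of `x` and `y`, centred at `a` and `b` respectively,
multiplied by `√(n + m)` and divided by the pooled sample standard deviation. -/
def statistic (d : ℕ) (c a b : ℝ) {n m : ℕ} (x : Fin n → ℝ) (y : Fin m → ℝ) : ℝ :=
  Real.sqrt ((n : ℝ) + (m : ℝ)) / pooledSampleStd d c x y *
    ((sampleMean x - a) - (sampleMean y - b))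

end

end WiTS

namespace WiTS

/-- Convergence in distribution only depends on the laws, and only on the laws of eventually all
the terms of the sequence. -/
lemma tendstoInDistribution_congr_law {ι E Ω₁ Ω₁' : Type*} {Ω₂ Ω₂' : ι → Type*}
    [TopologicalSpace E] [MeasurableSpace E] [OpensMeasurableSpace E]
    [MeasurableSpace Ω₁] [MeasurableSpace Ω₁'] [∀ i, MeasurableSpace (Ω₂ i)]
    [∀ i, MeasurableSpace (Ω₂' i)] {l : Filter ι}
    {μ : ∀ i, Measure (Ω₂ i)} [∀ i, IsProbabilityMeasure (μ i)]
    {μ' : ∀ i, Measure (Ω₂' i)} [∀ i, IsProbabilityMeasure (μ' i)]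
    {ν : Measure Ω₁} [IsProbabilityMeasure ν] {ν' : Measure Ω₁'} [IsProbabilityMeasure ν']
    {X : ∀ i, Ω₂ i → E} {X' : ∀ i, Ω₂' i → E} {Z : Ω₁ → E} {Z' : Ω₁' → E}
    (h : TendstoInDistribution X l Z μ ν)
    (hX' : ∀ i, AEMeasurable (X' i) (μ' i)) (hZ' : AEMeasurable Z' ν')
    (hlaw : ∀ᶠ i in l, (μ' i).map (X' i) = (μ i).map (X i))
    (hlim : ν'.map Z' = ν.map Z) :
    TendstoInDistribution X' l Z' μ' ν' where
  forall_aemeasurable := hX'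
  aemeasurable_limit := hZ'
  tendsto := by
    have key : (⟨ν'.map Z', Measure.isProbabilityMeasure_map hZ'⟩ : ProbabilityMeasure E) =
        ⟨ν.map Z, Measure.isProbabilityMeasure_map h.aemeasurable_limit⟩ := Subtype.ext hlim
    rw [key]
    refine h.tendsto.congr' ?_
    filter_upwards [hlaw] with i hi
    exact Subtype.ext hi.symm

/-- If `A k` and `B k` are independent and converge in distribution to centred Gaussian variables,
their sum converges in distribution to a Gaussian variable with the sum of the variances. -/
lemma tendstoInDistribution_add_gaussian {Ω : Type*} [MeasurableSpace Ω] {μ : Measure Ω}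
    [IsProbabilityMeasure μ] {A B : ℕ → Ω → ℝ} {u v : NNReal}
    (hA : TendstoInDistribution A atTop (id : ℝ → ℝ) (fun _ => μ) (gaussianReal 0 u))
    (hB : TendstoInDistribution B atTop (id : ℝ → ℝ) (fun _ => μ) (gaussianReal 0 v))
    (hAB : ∀ k, IndepFun (A k) (B k) μ) :
    TendstoInDistribution (fun k => A k + B k) atTop (id : ℝ → ℝ) (fun _ => μ)
      (gaussianReal 0 (u + v)) where
  forall_aemeasurable k := (hA.forall_aemeasurable k).add (hB.forall_aemeasurable k)
  tendsto := by
    refine ProbabilityMeasure.tendsto_iff_tendsto_charFun.2 fun t => ?_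
    have h1 := ProbabilityMeasure.tendsto_iff_tendsto_charFun.1 hA.tendsto t
    have h2 := ProbabilityMeasure.tendsto_iff_tendsto_charFun.1 hB.tendsto t
    have h3 := h1.mul h2
    simp only [ProbabilityMeasure.coe_mk, Measure.map_id] at h3 ⊢
    have hconv : gaussianReal 0 (u + v) = gaussianReal 0 u ∗ gaussianReal 0 v := by
      rw [gaussianReal_conv_gaussianReal, add_zero]
    rw [hconv, charFun_conv]
    refine h3.congr fun k => ?_
    rw [(hAB k).charFun_map_add_eq_mul (hA.forall_aemeasurable k) (hB.forall_aemeasurable k)]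
    rfl

/-- The central limit theorem along sample sizes tending to infinity, with a convergent factor. -/
lemma tendstoInDistribution_mul_inv_sqrt_mul_sum_sub {Ω : Type*} [MeasurableSpace Ω]
    {μ : Measure Ω} [IsProbabilityMeasure μ] {U : ℕ → Ω → ℝ} (hU : MemLp (U 0) 2 μ)
    (hindep : iIndepFun U μ) (hident : ∀ i, IdentDistrib (U i) (U 0) μ μ)
    {n : ℕ → ℕ} (hn : Tendsto n atTop atTop) {α : ℕ → ℝ} {a : ℝ} (hα : Tendsto α atTop (𝓝 a)) :
    TendstoInDistribution
      (fun k ω => α k * ((√(n k : ℝ))⁻¹ * (∑ i ∈ Finset.range (n k), U i ω - n k * μ[U 0])))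
      atTop (id : ℝ → ℝ) (fun _ => μ) (gaussianReal 0 (a ^ 2 * Var[U 0; μ]).toNNReal) := by
  have clt := tendstoInDistribution_inv_sqrt_mul_sum_sub
    (P' := gaussianReal 0 Var[U 0; μ].toNNReal) (Y := id) HasLaw.id hU hindep hident
  have clt' : TendstoInDistribution
      (fun k ω => (√(n k : ℝ))⁻¹ * (∑ i ∈ Finset.range (n k), U i ω - n k * μ[U 0]))
      atTop (id : ℝ → ℝ) (fun _ => μ) (gaussianReal 0 Var[U 0; μ].toNNReal) :=
    ⟨fun k => clt.forall_aemeasurable (n k), clt.aemeasurable_limit, clt.tendsto.comp hn⟩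
  have slutsky := clt'.continuous_comp_prodMk_of_tendstoInMeasure_const
    (Y := fun k _ => α k) (c := a) (g := fun p : ℝ × ℝ => p.2 * p.1) (by fun_prop)
    (tendstoInMeasure_of_tendsto_ae (fun k => aestronglyMeasurable_const) (ae_of_all _ fun _ => hα))
    (fun k => aemeasurable_const)
  refine tendstoInDistribution_congr_law slutsky slutsky.forall_aemeasurable (by fun_prop)
    (Eventually.of_forall fun _ => rfl) ?_
  simp only [id_eq, Measure.map_id]
  rw [gaussianReal_map_const_mul, mul_zero]
  congr 1
  ext
  simp [Real.coe_toNNReal _ (variance_nonneg _ _),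
    Real.coe_toNNReal _ (mul_nonneg (sq_nonneg a) (variance_nonneg _ _))]

lemma sampleMean_eq_sum_range (n : ℕ) (u : ℕ → ℝ) :
    sampleMean (fun i : Fin n => u i) = (∑ i ∈ Finset.range n, u i) / n := by
  rw [sampleMean, Fin.sum_univ_eq_sum_range]

lemma sampleVariance_eq {n : ℕ} (d : ℕ) (hn : n ≠ 0) (u : ℕ → ℝ) :
    sampleVariance d (fun i : Fin n => u i) =
      ((∑ i ∈ Finset.range n, u i ^ 2) / n - ((∑ i ∈ Finset.range n, u i) / n) ^ 2) *
        ((n : ℝ) / ((n : ℝ) - d)) := by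
  have hn' : (n : ℝ) ≠ 0 := by exact_mod_cast hn
  rw [sampleVariance, sampleMean_eq_sum_range,
    Fin.sum_univ_eq_sum_range (fun i => (u i - (∑ i ∈ Finset.range n, u i) / n) ^ 2) n]
  set s := ∑ i ∈ Finset.range n, u i with hs
  have h : ∑ i ∈ Finset.range n, (u i - s / n) ^ 2 =
      ((∑ i ∈ Finset.range n, u i ^ 2) / n - (s / n) ^ 2) * n := by
    simp only [sub_sq, Finset.sum_add_distrib, Finset.sum_sub_distrib, ← Finset.sum_mul,
      ← Finset.mul_sum, Finset.sum_const, Finset.card_range, nsmul_eq_mul, ← hs]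
    field_simp
    ring
  rw [h, mul_div_assoc]

lemma tendsto_natCast_div_sub (d : ℕ) :
    Tendsto (fun n : ℕ => (n : ℝ) / ((n : ℝ) - d)) atTop (𝓝 1) := by
  have h : Tendsto (fun n : ℕ => (1 - (d : ℝ) / n)⁻¹) atTop (𝓝 (1 - 0)⁻¹) :=
    (tendsto_const_nhds.sub (tendsto_const_div_atTop_nhds_zero_nat (d : ℝ))).inv₀ (by simp)
  rw [sub_zero, inv_one] at h
  refine h.congr' ?_
  filter_upwards [eventually_gt_atTop 0] with n hn
  have : (n : ℝ) ≠ 0 := by exact_mod_cast hn.ne'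
  rw [one_sub_div this, inv_div]

/-- Strong consistency of the sample variance. -/
lemma ae_tendsto_sampleVariance {Ω : Type*} [MeasurableSpace Ω]
    {μ : Measure Ω} [IsProbabilityMeasure μ] {U : ℕ → Ω → ℝ} (hU : MemLp (U 0) 2 μ)
    (hindep : iIndepFun U μ) (hident : ∀ i, IdentDistrib (U i) (U 0) μ μ) (d : ℕ) :
    ∀ᵐ ω ∂μ, Tendsto (fun n : ℕ => sampleVariance d (fun i : Fin n => U i ω)) atTop
      (𝓝 Var[U 0; μ]) := by
  have h1 := strong_law_ae_real U (hU.integrable (by norm_num))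
    (fun i j hij => hindep.indepFun hij) hident
  have h2 := strong_law_ae_real (fun i ω => U i ω ^ 2) hU.integrable_sq
    (fun i j hij => (hindep.indepFun hij).comp (φ := fun x : ℝ => x ^ 2)
      (ψ := fun x : ℝ => x ^ 2) (by fun_prop) (by fun_prop))
    (fun i => (hident i).comp (u := fun x : ℝ => x ^ 2) (by fun_prop))
  filter_upwards [h1, h2] with ω hω1 hω2
  have h3 := (hω2.sub (hω1.pow 2)).mul (tendsto_natCast_div_sub d)
  rw [mul_one] at h3
  rw [variance_eq_sub hU]
  refine h3.congr' ?_
  filter_upwards [eventually_ne_atTop 0] with n hn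
  rw [sampleVariance_eq d hn fun i => U i ω]

lemma measurable_statistic {Ω : Type*} [MeasurableSpace Ω] {n m : ℕ} {f : Fin n → Ω → ℝ}
    {g : Fin m → Ω → ℝ} (hf : ∀ i, Measurable (f i)) (hg : ∀ j, Measurable (g j))
    (d : ℕ) (c a b : ℝ) :
    Measurable fun ω => statistic d c a b (fun i => f i ω) (fun j => g j ω) := by
  unfold statistic pooledSampleStd sampleVariance sampleMean
  fun_prop

lemma aemeasurable_statistic {Ω : Type*} [MeasurableSpace Ω] {μ : Measure Ω} {n m : ℕ}
    {f : Fin n → Ω → ℝ} {g : Fin m → Ω → ℝ} (hf : ∀ i, AEMeasurable (f i) μ)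
    (hg : ∀ j, AEMeasurable (g j) μ) (d : ℕ) (c a b : ℝ) :
    AEMeasurable (fun ω => statistic d c a b (fun i => f i ω) (fun j => g j ω)) μ := by
  unfold statistic pooledSampleStd sampleVariance sampleMean
  fun_prop

lemma tendsto_atTop_of_tendsto_div {n N : ℕ → ℕ} {c : ℝ} (hc : 0 < c)
    (hN : Tendsto N atTop atTop) (h : Tendsto (fun k => (n k : ℝ) / N k) atTop (𝓝 c)) :
    Tendsto n atTop atTop := by
  have h1 : Tendsto (fun k => (n k : ℝ) / N k * N k) atTop atTop :=
    h.pos_mul_atTop hc (tendsto_natCast_atTop_atTop.comp hN)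
  refine tendsto_natCast_atTop_iff.1 (h1.congr' ?_)
  filter_upwards [hN.eventually_ne_atTop 0] with k hk
  rw [div_mul_cancel₀ _ (by exact_mod_cast hk)]

lemma indepFun_sum_inl_sum_inr {Ω : Type*} [MeasurableSpace Ω] {μ : Measure Ω}
    {W : ℕ ⊕ ℕ → Ω → ℝ} (hW : iIndepFun W μ) (hmeas : ∀ s, Measurable (W s)) (n m : ℕ) :
    IndepFun (fun ω => ∑ i ∈ Finset.range n, W (.inl i) ω)
      (fun ω => ∑ j ∈ Finset.range m, W (.inr j) ω) μ := by
  have h := hW.indepFun_finset ((Finset.range n).map .inl) ((Finset.range m).map .inr)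
    (Finset.disjoint_left.2 (by simp)) hmeas
  have h' := h.comp (φ := fun w => ∑ i, w i) (ψ := fun w => ∑ i, w i) (by fun_prop) (by fun_prop)
  convert h' using 1 <;>
  · ext ω
    simp only [Function.comp_apply]
    rw [Finset.sum_coe_sort _ (fun s => W s ω), Finset.sum_map]
    rfl

/-- The numerator of the statistic as a sum of two normalized centred sums. -/
lemma sqrt_mul_sampleMean_sub {n m : ℕ} (hn : n ≠ 0) (hm : m ≠ 0) (u v : ℕ → ℝ) (a b : ℝ) :
    √((n : ℝ) + m) * ((sampleMean (fun i : Fin n => u i) - a) -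
        (sampleMean (fun j : Fin m => v j) - b)) =
      (√((n : ℝ) / (n + m)))⁻¹ * ((√(n : ℝ))⁻¹ * (∑ i ∈ Finset.range n, u i - n * a)) +
      -(√((m : ℝ) / (n + m)))⁻¹ * ((√(m : ℝ))⁻¹ * (∑ j ∈ Finset.range m, v j - m * b)) := by
  have hn' : (0 : ℝ) < n := by positivity
  have hm' : (0 : ℝ) < m := by positivity
  have key : ∀ x s e : ℝ, 0 < x → (√(x / ((n : ℝ) + m)))⁻¹ * ((√x)⁻¹ * (s - x * e)) =
      √((n : ℝ) + m) * (s / x - e) := by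
    intro x s e hx
    rw [Real.sqrt_div hx.le, inv_div, div_mul_eq_mul_div, mul_div_assoc, inv_mul_eq_div, div_div,
      Real.mul_self_sqrt hx.le, sub_div, mul_div_cancel_left₀ _ hx.ne']
  rw [neg_mul, key _ _ _ hn', key _ _ _ hm', sampleMean_eq_sum_range, sampleMean_eq_sum_range]
  ring

/-- Asymptotic normality when both samples are taken from fixed infinite i.i.d. sequences. -/
lemma tendstoInDistribution_statistic_of_sequences {Ω : Type*} [MeasurableSpace Ω]
    {μ : Measure Ω} [IsProbabilityMeasure μ] {W : ℕ ⊕ ℕ → Ω → ℝ}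
    (hW : iIndepFun W μ) (hmeas : ∀ s, Measurable (W s))
    (hidl : ∀ i, IdentDistrib (W (.inl i)) (W (.inl 0)) μ μ)
    (hidr : ∀ j, IdentDistrib (W (.inr j)) (W (.inr 0)) μ μ)
    (hl : MemLp (W (.inl 0)) 2 μ) (hr : MemLp (W (.inr 0)) 2 μ)
    (hvl : 0 < Var[W (.inl 0); μ]) (hvr : 0 < Var[W (.inr 0); μ])
    {n m : ℕ → ℕ} {c : ℝ} (hc : c ∈ Set.Ioo (0 : ℝ) 1)
    (hsize : Tendsto (fun k => n k + m k) atTop atTop)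
    (hratio : Tendsto (fun k => (n k : ℝ) / ((n k : ℝ) + (m k : ℝ))) atTop (𝓝 c))
    (d : ℕ) {w : ℕ → ℝ} (hw : Tendsto w atTop (𝓝 c)) :
    TendstoInDistribution
      (fun k ω => statistic d (w k) μ[W (.inl 0)] μ[W (.inr 0)]
        (fun i : Fin (n k) => W (.inl i) ω) (fun j : Fin (m k) => W (.inr j) ω))
      atTop (id : ℝ → ℝ) (fun _ => μ) (gaussianReal 0 1) := by
  have hc1 : 0 < 1 - c := sub_pos.2 hc.2
  have hratio' : Tendsto (fun k => (m k : ℝ) / ((n k : ℝ) + (m k : ℝ))) atTop (𝓝 (1 - c)) := by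
    refine (hratio.const_sub 1).congr' ?_
    filter_upwards [hsize.eventually_ne_atTop 0] with k hk
    have : (n k : ℝ) + m k ≠ 0 := by exact_mod_cast hk
    rw [one_sub_div this, add_sub_cancel_left]
  have hn : Tendsto n atTop atTop :=
    tendsto_atTop_of_tendsto_div hc.1 hsize (by simpa using hratio)
  have hm : Tendsto m atTop atTop :=
    tendsto_atTop_of_tendsto_div hc1 hsize (by simpa using hratio')
  have hindl : iIndepFun (fun i => W (.inl i)) μ := hW.precomp Sum.inl_injective
  have hindr : iIndepFun (fun j => W (.inr j)) μ := hW.precomp Sum.inr_injective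
  have hA := tendstoInDistribution_mul_inv_sqrt_mul_sum_sub hl hindl hidl hn
    (hratio.sqrt.inv₀ (Real.sqrt_pos.2 hc.1).ne')
  have hB := tendstoInDistribution_mul_inv_sqrt_mul_sum_sub hr hindr hidr hm
    (hratio'.sqrt.inv₀ (Real.sqrt_pos.2 hc1).ne').neg
  have hAB := tendstoInDistribution_add_gaussian hA hB fun k =>
    (indepFun_sum_inl_sum_inr hW hmeas (n k) (m k)).comp
      (φ := fun s => (√((n k : ℝ) / (n k + m k)))⁻¹ * ((√(n k : ℝ))⁻¹ * (s - n k * ∫ ω, W (.inl 0) ω ∂μ)))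
      (ψ := fun s => -(√((m k : ℝ) / (n k + m k)))⁻¹ *
        ((√(m k : ℝ))⁻¹ * (s - m k * ∫ ω, W (.inr 0) ω ∂μ))) (by fun_prop) (by fun_prop)
  set V : ℝ := Var[W (.inl 0); μ] / c + Var[W (.inr 0); μ] / (1 - c) with hV
  have hVpos : 0 < V := add_pos (div_pos hvl hc.1) (div_pos hvr hc1)
  have hstd_meas : ∀ k, Measurable fun ω => (pooledSampleStd d (w k)
      (fun i : Fin (n k) => W (.inl i) ω) (fun j : Fin (m k) => W (.inr j) ω))⁻¹ := by
    intro k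
    unfold pooledSampleStd sampleVariance sampleMean
    fun_prop
  have hstd : ∀ᵐ ω ∂μ, Tendsto (fun k => (pooledSampleStd d (w k)
      (fun i : Fin (n k) => W (.inl i) ω) (fun j : Fin (m k) => W (.inr j) ω))⁻¹)
      atTop (𝓝 (√V)⁻¹) := by
    filter_upwards [ae_tendsto_sampleVariance hl hindl hidl d,
      ae_tendsto_sampleVariance hr hindr hidr d] with ω h1 h2
    exact ((((h1.comp hn).div hw hc.1.ne').add
      ((h2.comp hm).div (hw.const_sub 1) hc1.ne')).sqrt).inv₀ (Real.sqrt_pos.2 hVpos).ne'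
  have slutsky := hAB.continuous_comp_prodMk_of_tendstoInMeasure_const
    (g := fun p : ℝ × ℝ => p.2 * p.1) (by fun_prop)
    (tendstoInMeasure_of_tendsto_ae (fun k => (hstd_meas k).aestronglyMeasurable) hstd)
    (fun k => (hstd_meas k).aemeasurable)
  refine tendstoInDistribution_congr_law slutsky (fun k => ?_) (by fun_prop) ?_ ?_
  · exact (measurable_statistic (fun i : Fin (n k) => hmeas (.inl i))
      (fun j : Fin (m k) => hmeas (.inr j)) d _ _ _).aemeasurable
  · filter_upwards [hn.eventually_ne_atTop 0, hm.eventually_ne_atTop 0] with k hnk hmk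
    congr 1
    ext ω
    simp only [statistic, Pi.add_apply]
    rw [← sqrt_mul_sampleMean_sub hnk hmk (fun i => W (.inl i) ω) (fun j => W (.inr j) ω),
      div_eq_mul_inv, mul_comm √_, mul_assoc]
  · simp only [id_eq, Measure.map_id]
    rw [gaussianReal_map_const_mul, mul_zero]
    congr 1
    ext
    have e1 : (-(√(1 - c))⁻¹) ^ 2 * Var[W (.inr 0); μ] = Var[W (.inr 0); μ] / (1 - c) := by
      rw [neg_sq, inv_pow, Real.sq_sqrt hc1.le, inv_mul_eq_div]
    have e2 : ((√c)⁻¹) ^ 2 * Var[W (.inl 0); μ] = Var[W (.inl 0); μ] / c := by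
      rw [inv_pow, Real.sq_sqrt hc.1.le, inv_mul_eq_div]
    rw [e1, e2, ← Real.toNNReal_add (div_pos hvl hc.1).le (div_pos hvr hc1).le, ← hV]
    simp [Real.coe_toNNReal _ hVpos.le, Real.sq_sqrt hVpos.le, hVpos.ne']

/-- The law of a pair of finite independent samples is the product of the marginal laws. -/
lemma map_samples_eq_pi {Ω 𝒳 : Type*} [MeasurableSpace Ω] [MeasurableSpace 𝒳] {μ : Measure Ω}
    [IsProbabilityMeasure μ] {P Q : Measure 𝒳} {n m : ℕ} {X : Fin n → Ω → 𝒳} {Y : Fin m → Ω → 𝒳}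
    (hX : ∀ i, HasLaw (X i) P μ) (hY : ∀ j, HasLaw (Y j) Q μ)
    (hindep : iIndepFun (fun s : Fin n ⊕ Fin m => Sum.elim X Y s) μ) :
    μ.map (fun ω s => Sum.elim X Y s ω) = Measure.pi (Sum.elim (fun _ => P) (fun _ => Q)) := by
  have hmeas : ∀ s, AEMeasurable (Sum.elim X Y s) μ := by
    rintro (i | j)
    · exact (hX i).aemeasurable
    · exact (hY j).aemeasurable
  rw [(iIndepFun_iff_map_fun_eq_pi_map hmeas).1 hindep]
  congr 1
  ext1 s
  rcases s with i | j
  · exact (hX i).map_eq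
  · exact (hY j).map_eq

/-- A measurable function of two samples has a law that only depends on the laws of the points,
as soon as all the points are independent. -/
lemma map_comp_samples_eq {Ω Ω' 𝒳 E : Type*} [MeasurableSpace Ω] [MeasurableSpace Ω']
    [MeasurableSpace 𝒳] [MeasurableSpace E] {μ : Measure Ω} [IsProbabilityMeasure μ]
    {μ' : Measure Ω'} [IsProbabilityMeasure μ'] {P Q : Measure 𝒳} {n m : ℕ}
    {X : Fin n → Ω → 𝒳} {Y : Fin m → Ω → 𝒳} {X' : Fin n → Ω' → 𝒳} {Y' : Fin m → Ω' → 𝒳}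
    (hX : ∀ i, HasLaw (X i) P μ) (hY : ∀ j, HasLaw (Y j) Q μ)
    (hX' : ∀ i, HasLaw (X' i) P μ') (hY' : ∀ j, HasLaw (Y' j) Q μ')
    (hindep : iIndepFun (fun s : Fin n ⊕ Fin m => Sum.elim X Y s) μ)
    (hindep' : iIndepFun (fun s : Fin n ⊕ Fin m => Sum.elim X' Y' s) μ')
    {T : (Fin n → 𝒳) × (Fin m → 𝒳) → E} (hT : Measurable T) :
    μ.map (fun ω => T (fun i => X i ω, fun j => Y j ω)) =
      μ'.map (fun ω => T (fun i => X' i ω, fun j => Y' j ω)) := by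
  have hS : Measurable fun z : Fin n ⊕ Fin m → 𝒳 => T (z ∘ Sum.inl, z ∘ Sum.inr) := by
    refine hT.comp (Measurable.prodMk ?_ ?_) <;>
      exact measurable_pi_lambda _ fun _ => measurable_pi_apply _
  have hXY : AEMeasurable (fun ω s => Sum.elim X Y s ω) μ := by
    refine aemeasurable_pi_lambda _ ?_
    rintro (i | j)
    · exact (hX i).aemeasurable
    · exact (hY j).aemeasurable
  have hXY' : AEMeasurable (fun ω s => Sum.elim X' Y' s ω) μ' := by
    refine aemeasurable_pi_lambda _ ?_
    rintro (i | j)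
    · exact (hX' i).aemeasurable
    · exact (hY' j).aemeasurable
  have h1 := AEMeasurable.map_map_of_aemeasurable hS.aemeasurable hXY
  have h2 := AEMeasurable.map_map_of_aemeasurable hS.aemeasurable hXY'
  rw [map_samples_eq_pi hX hY hindep] at h1
  rw [map_samples_eq_pi hX' hY' hindep'] at h2
  exact h1.symm.trans h2

/-- Asymptotic normality for triangular arrays of samples and any weights tending to `c`. -/
theorem tendstoInDistribution_statistic {𝒳 : Type*} [MeasurableSpace 𝒳]
    {P Q : Measure 𝒳} [IsProbabilityMeasure P] [IsProbabilityMeasure Q]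
    {h : 𝒳 → ℝ} (hh : Measurable h)
    (hP_pos : 0 < evariance h P) (hP_fin : evariance h P < ⊤)
    (hQ_pos : 0 < evariance h Q) (hQ_fin : evariance h Q < ⊤)
    {n m : ℕ → ℕ} {c : ℝ} (hc : c ∈ Set.Ioo (0 : ℝ) 1)
    (hsize : Tendsto (fun k => n k + m k) atTop atTop)
    (hratio : Tendsto (fun k => (n k : ℝ) / ((n k : ℝ) + (m k : ℝ))) atTop (𝓝 c))
    {Ω : ℕ → Type*} [∀ k, MeasurableSpace (Ω k)]
    {μ : (k : ℕ) → Measure (Ω k)} [∀ k, IsProbabilityMeasure (μ k)]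
    {X : (k : ℕ) → Fin (n k) → Ω k → 𝒳} {Y : (k : ℕ) → Fin (m k) → Ω k → 𝒳}
    (hX : ∀ k i, HasLaw (X k i) P (μ k)) (hY : ∀ k j, HasLaw (Y k j) Q (μ k))
    (hindep : ∀ k, iIndepFun
      (fun (s : Fin (n k) ⊕ Fin (m k)) => Sum.elim (X k) (Y k) s) (μ k))
    (d : ℕ) {w : ℕ → ℝ} (hw : Tendsto w atTop (𝓝 c)) :
    TendstoInDistribution
      (fun k ω => statistic d (w k) (∫ x, h x ∂P) (∫ y, h y ∂Q)
        (fun i => h (X k i ω)) (fun j => h (Y k j ω)))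
      atTop (id : ℝ → ℝ) μ (gaussianReal 0 1) := by
  have hPQ : ∀ s : ℕ ⊕ ℕ, IsProbabilityMeasure (Sum.elim (fun _ => P) (fun _ => Q) s) := by
    rintro (_ | _) <;> simpa
  obtain ⟨Ω', _, μ', W, hWmeas, hWlaw, hWindep, _⟩ := exists_hasLaw_indepFun
    (fun _ : ℕ ⊕ ℕ => 𝒳) (fun s => Sum.elim (fun _ => P) (fun _ => Q) s)
  have hlawl : ∀ i, HasLaw (W (.inl i)) P μ' := fun i => hWlaw (.inl i)
  have hlawr : ∀ j, HasLaw (W (.inr j)) Q μ' := fun j => hWlaw (.inr j)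
  have hPmem : MemLp h 2 P := (evariance_lt_top_iff_memLp hh.aestronglyMeasurable).1 hP_fin
  have hQmem : MemLp h 2 Q := (evariance_lt_top_iff_memLp hh.aestronglyMeasurable).1 hQ_fin
  have hident : ∀ {ν : Measure 𝒳} {f g : Ω' → 𝒳}, HasLaw f ν μ' → HasLaw g ν μ' →
      IdentDistrib (fun ω => h (f ω)) (fun ω => h (g ω)) μ' μ' := fun hf hg =>
    IdentDistrib.comp ⟨hf.aemeasurable, hg.aemeasurable, hf.map_eq.trans hg.map_eq.symm⟩ hh
  have hmem : ∀ {ν : Measure 𝒳} {f : Ω' → 𝒳}, HasLaw f ν μ' → MemLp h 2 ν →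
      MemLp (fun ω => h (f ω)) 2 μ' := fun hf hν =>
    MemLp.comp_of_map (by rwa [hf.map_eq]) hf.aemeasurable
  have hmean : ∀ {ν : Measure 𝒳} {f : Ω' → 𝒳}, HasLaw f ν μ' →
      ∫ ω, h (f ω) ∂μ' = ∫ x, h x ∂ν := fun hf => hf.integral_comp hh.aestronglyMeasurable
  have hvar : ∀ {ν : Measure 𝒳} {f : Ω' → 𝒳}, HasLaw f ν μ' →
      0 < evariance h ν → evariance h ν < ⊤ → 0 < Var[fun ω => h (f ω); μ'] := by
    intro ν f hf hpos hfin
    have hmap := variance_map (X := h) (by fun_prop) hf.aemeasurable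
    rw [hf.map_eq] at hmap
    change 0 < Var[h ∘ f; μ']
    rw [← hmap]
    exact ENNReal.toReal_pos hpos.ne' hfin.ne
  have core := tendstoInDistribution_statistic_of_sequences (W := fun s ω => h (W s ω))
    (hWindep.comp (fun _ => h) fun _ => hh) (fun s => hh.comp (hWmeas s))
    (fun i => hident (hlawl i) (hlawl 0)) (fun j => hident (hlawr j) (hlawr 0))
    (hmem (hlawl 0) hPmem) (hmem (hlawr 0) hQmem)
    (hvar (hlawl 0) hP_pos hP_fin) (hvar (hlawr 0) hQ_pos hQ_fin) hc hsize hratio d hw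
  rw [hmean (hlawl 0), hmean (hlawr 0)] at core
  refine tendstoInDistribution_congr_law core (fun k => ?_) (by fun_prop)
    (Eventually.of_forall fun k => ?_) rfl
  · exact aemeasurable_statistic (fun i => hh.comp_aemeasurable (hX k i).aemeasurable)
      (fun j => hh.comp_aemeasurable (hY k j).aemeasurable) d _ _ _
  · have hinj : Function.Injective
        (Sum.map Fin.val Fin.val : Fin (n k) ⊕ Fin (m k) → ℕ ⊕ ℕ) :=
      Fin.val_injective.sumMap Fin.val_injective
    have hWk : iIndepFun (fun s : Fin (n k) ⊕ Fin (m k) =>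
        Sum.elim (fun i : Fin (n k) => W (.inl i)) (fun j : Fin (m k) => W (.inr j)) s) μ' := by
      convert hWindep.precomp hinj using 1
      ext1 (i | j) <;> rfl
    have hT : Measurable fun p : (Fin (n k) → 𝒳) × (Fin (m k) → 𝒳) =>
        statistic d (w k) (∫ x, h x ∂P) (∫ y, h y ∂Q)
          (fun i => h (p.1 i)) (fun j => h (p.2 j)) :=
      measurable_statistic (fun i => by fun_prop) (fun j => by fun_prop) d _ _ _
    have key := map_comp_samples_eq (hX k) (hY k) (fun i : Fin (n k) => hlawl i)
      (fun j : Fin (m k) => hlawr j) (hindep k) hWk hT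
    exact key

end WiTS

theorem theorem1
    {𝒳 : Type*} [MeasurableSpace 𝒳]
    (P Q : Measure 𝒳) [IsProbabilityMeasure P] [IsProbabilityMeasure Q]
    -- the fixed witness function, with finite positive variances under `P` and `Q`
    (h : 𝒳 → ℝ) (hh : Measurable h)
    (hP_pos : 0 < evariance h P) (hP_fin : evariance h P < ⊤)
    (hQ_pos : 0 < evariance h Q) (hQ_fin : evariance h Q < ⊤)
    -- the sample sizes
    (n m : ℕ → ℕ) (c : ℝ) (hc : c ∈ Set.Ioo (0 : ℝ) 1)
    (hsize : Tendsto (fun k => n k + m k) atTop atTop)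
    (hratio : Tendsto (fun k => (n k : ℝ) / ((n k : ℝ) + (m k : ℝ))) atTop (𝓝 c))
    -- for each `k`, two samples of sizes `n k` and `m k`, all the points being independent
    {Ω : ℕ → Type*} [∀ k, MeasurableSpace (Ω k)]
    (μ : (k : ℕ) → Measure (Ω k)) [∀ k, IsProbabilityMeasure (μ k)]
    (X : (k : ℕ) → Fin (n k) → Ω k → 𝒳) (Y : (k : ℕ) → Fin (m k) → Ω k → 𝒳)
    (hX : ∀ k i, HasLaw (X k i) P (μ k)) (hY : ∀ k j, HasLaw (Y k j) Q (μ k))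
    (hindep : ∀ k, iIndepFun
      (fun (s : Fin (n k) ⊕ Fin (m k)) => Sum.elim (X k) (Y k) s) (μ k))
    -- the normalization of the sample variances: `1 / n` or `1 / (n - 1)`
    (d : ℕ) (hd : d = 0 ∨ d = 1) :
    -- with the limiting proportion as the weight
    TendstoInDistribution
      (fun k ω => WiTS.statistic d c (∫ x, h x ∂P) (∫ y, h y ∂Q)
        (fun i => h (X k i ω)) (fun j => h (Y k j ω)))
      atTop (id : ℝ → ℝ) μ (gaussianReal 0 1) ∧
    -- with the actual proportion `n / (n + m)` as the weight
    TendstoInDistribution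
      (fun k ω => WiTS.statistic d ((n k : ℝ) / ((n k : ℝ) + (m k : ℝ)))
        (∫ x, h x ∂P) (∫ y, h y ∂Q)
        (fun i => h (X k i ω)) (fun j => h (Y k j ω)))
      atTop (id : ℝ → ℝ) μ (gaussianReal 0 1) :=
  ⟨WiTS.tendstoInDistribution_statistic hh hP_pos hP_fin hQ_pos hQ_fin hc hsize hratio hX hY hindep
    d tendsto_const_nhds,
  WiTS.tendstoInDistribution_statistic hh hP_pos hP_fin hQ_pos hQ_fin hc hsize hratio hX hY hindep
    d hratio⟩
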